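/- For integers $k\ge 1$ and $m\ge 0$ let $F_k(m)$ be the total number of occurrences of the part $k$ across all partitions of $m$, and for $s\ge 0$ put $M_s(m)=\sum_{k\ge 1}k^sF_k(m)$. For $\tau$ in the upper half plane $\mathbb H$ let $q=e^{2\pi i\tau}$ and, for real $r$, $q^{r}=e^{2\pi i r\tau}$; let $\eta(\tau)=q^{1/24}\prod_{r\ge1}(1-q^r)$ and $\Delta=\eta^{24}$, let $E_k$ be the Eisenstein series of weight $k$ for $\mathrm{SL}_2(\mathbb Z)$ normalized to have constant term $1$, and let $j=E_4^3/\Delta$. Let $B_k$ denote the Bernoulli numbers. Let $n\ge 1$. Then $B_{12n}\ne 0$, so that $C_{12n}=-24n/B_{12n}$ is a nonzero rational number; there is exactly one polynomial $P_n\in\mathbb Q[X]$ with $$E_{12n}(\tau)=\Delta(\tau)^n\,P_n(j(\tau))\qquad\text{for all }\tau\in\mathbb H;$$ and for all $\tau\in\mathbb H$ the series $\sum_{m\ge1}M_{12n-1}(m)q^m$ converges absolutely and $$q^{-1/24}\sum_{m\ge1}M_{12n-1}(m)\,q^m=\frac{1}{C_{12n}}\Bigl(\eta(\tau)^{24n-1}P_n(j(\tau))-\eta(\tau)^{-1}\Bigr).$$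 -/

import Mathlib

/-- `F_k(n)`: the total number of occurrences of the part `k` across all partitions of `n`. -/
def partFrequency (k n : ℕ) : ℕ :=
  ∑ p : Nat.Partition n, p.parts.count k

/-- A part `k > n` never occurs in a partition of `n`. -/
theorem partFrequency_eq_zero_of_lt {k n : ℕ} (h : n < k) : partFrequency k n = 0 := by
  refine Finset.sum_eq_zero fun p _ => Multiset.count_eq_zero.2 fun hk => ?_
  have := Multiset.le_sum_of_mem hk
  rw [p.parts_sum] at this
  omega

/-- The frequency moment `M_s(n) = ∑_{k ≥ 1} k ^ s F_k(n)`. The sum may stop at `k = n`, see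
`partFrequency_eq_zero_of_lt`. -/
def frequencyMoment (s n : ℕ) : ℕ :=
  ∑ k ∈ Finset.Icc 1 n, k ^ s * partFrequency k n

/-- Klein's modular invariant `j = E₄ ^ 3 / Δ`, where `Δ = η ^ 24`. -/
noncomputable def kleinJ (τ : UpperHalfPlane) : ℂ :=
  ModularForm.E₄ τ ^ 3 / ModularForm.discriminant τ

/-- The constant `C_{12n} = -24n / B_{12n}`. -/
def eisensteinConstant (n : ℕ) : ℚ :=
  -(24 * (n : ℚ)) / bernoulli (12 * n)

/-- The polynomial `P ∈ ℚ[j]` satisfies `E_{12n}(τ) = Δ(τ) ^ n P(j(τ))` on the upper half plane,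
where `E_{12n}` is the Eisenstein series of level one with constant term `1`. -/
def IsEisensteinPolynomial (n : ℕ) (hn : 1 ≤ n) (P : Polynomial ℚ) : Prop :=
  ∀ τ : UpperHalfPlane,
    ModularForm.E (k := 12 * n) (by omega) τ =
      ModularForm.discriminant τ ^ n * Polynomial.aeval (kleinJ τ) P

/-! Let `P(q)` be the generating function of the partition numbers. Removing one copy of `k` from a
partition shows that `A = ∑ F_k(m) q^m` satisfies `A = q^k (P + A)`, so `A = P q^k / (1 - q^k)`.
Weighting by `k^s` and summing over `k` gives a Lambert series, whence `∑ M_s(m) q^m = P(q) ∑ σ_s(m)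
q^m` (`hasSum_frequencyMoment`). Euler's product turns `q^(-1/24) P(q)` into `1/η` (`inv_eta_eq`),
and for `s = 12n - 1` the divisor sum is `(E_{12n} - 1) / C_{12n}`. Inserting `E_{12n} = Δ^n P_n(j)`
and `Δ = η^24` gives the identity.

The polynomial exists by descent on the weight: subtract a rational multiple of a power of `E₄` to
get a cusp form, then divide by `Δ` (`exists_polynomial_kleinJ`). It is unique because `j` is
unbounded at the cusp (`eq_zero_of_aeval_kleinJ_eq_zero`). -/

/-! ### Recursions from removing one part of a partition. -/

theorem sum_partition_filter_mem {M : Type*} [AddCommMonoid M] (f : Multiset ℕ → M) {a : ℕ}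
    (ha : 1 ≤ a) (m : ℕ) :
    ∑ p : Nat.Partition (m + a) with a ∈ p.parts, f p.parts =
      ∑ q : Nat.Partition m, f (a ::ₘ q.parts) := by
  have h : ∑ p : Nat.Partition (m + a) with a ∈ p.parts, f p.parts =
      ∑ q : Nat.Partition (m + a - a), f (a ::ₘ q.parts) := by
    rw [← Finset.sum_subtype_eq_sum_filter]
    simp only [Finset.subtype_univ]
    refine Fintype.sum_equiv (Nat.Partition.partitionWithPartEquiv ha (by omega)) _ _ fun p => ?_
    rw [Nat.Partition.partitionWithPartEquiv_apply_parts, Multiset.cons_erase p.2]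
  rwa [Nat.add_sub_cancel] at h

/-- The number of partitions of `n` all of whose parts exceed `N`. -/
def partitionCount (N n : ℕ) : ℕ :=
  ∑ p : Nat.Partition n, if ∀ i ∈ p.parts, N < i then 1 else 0

theorem partitionCount_zero (N : ℕ) : partitionCount N 0 = 1 := by
  simp [partitionCount]

theorem partitionCount_zero_left (n : ℕ) :
    partitionCount 0 n = Fintype.card (Nat.Partition n) := by
  rw [partitionCount, Finset.sum_congr rfl fun p _ => if_pos fun i hi => p.parts_pos hi]
  simp

theorem partitionCount_eq_zero {N n : ℕ} (h0 : n ≠ 0) (h : n ≤ N) : partitionCount N n = 0 := by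
  refine Finset.sum_eq_zero fun p _ => if_neg fun hp => h0 ?_
  rw [← p.parts_sum, Multiset.sum_eq_zero]
  intro i hi
  have := p.le_of_mem_parts hi
  have := hp i hi
  omega

theorem partitionCount_le (N n : ℕ) : partitionCount N n ≤ partitionCount 0 n := by
  refine Finset.sum_le_sum fun p _ => ?_
  have : ∀ i ∈ p.parts, 0 < i := fun i hi => p.parts_pos hi
  rw [if_pos this]
  split_ifs <;> simp

theorem partitionCount_succ_of_lt {N n : ℕ} (h : n < N + 1) :
    partitionCount N n = partitionCount (N + 1) n := by
  rcases eq_or_ne n 0 with rfl | h0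
  · simp [partitionCount_zero]
  · rw [partitionCount_eq_zero h0 (by omega), partitionCount_eq_zero h0 (by omega)]

/-- Split by whether `N + 1` occurs, and remove one copy if it does. On generating functions,
passing from `N` to `N + 1` is multiplication by `1 - q^(N+1)`. -/
theorem partitionCount_add (N m : ℕ) :
    partitionCount N (m + (N + 1)) =
      partitionCount (N + 1) (m + (N + 1)) + partitionCount N m := by
  have h1 : partitionCount N m = ∑ p : Nat.Partition (m + (N + 1)) with N + 1 ∈ p.parts,
      if ∀ i ∈ p.parts, N < i then 1 else 0 := by
    rw [sum_partition_filter_mem (fun s => if ∀ i ∈ s, N < i then 1 else 0) (by omega)]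
    simp [partitionCount]
  have h2 : partitionCount (N + 1) (m + (N + 1)) =
      ∑ p : Nat.Partition (m + (N + 1)) with N + 1 ∉ p.parts,
        if ∀ i ∈ p.parts, N < i then 1 else 0 := by
    rw [Finset.sum_filter]
    refine Finset.sum_congr rfl fun p _ => ?_
    have : (∀ i ∈ p.parts, N + 1 < i) ↔ N + 1 ∉ p.parts ∧ ∀ i ∈ p.parts, N < i := by
      refine ⟨fun h => ⟨fun h' => lt_irrefl _ (h _ h'), fun i hi => by have := h i hi; omega⟩,
        fun ⟨h, h'⟩ i hi => lt_of_le_of_ne (h' i hi) ?_⟩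
      rintro rfl
      exact h hi
    by_cases h : N + 1 ∈ p.parts <;> simp [this, h]
  rw [h1, h2, add_comm (Finset.sum _ _), Finset.sum_filter_add_sum_filter_not]
  rfl

/-- Only partitions containing `k` contribute; removing one copy of `k` loses exactly one
occurrence. -/
theorem partFrequency_add {k : ℕ} (hk : 1 ≤ k) (m : ℕ) :
    partFrequency k (m + k) = partitionCount 0 m + partFrequency k m := by
  have h : partFrequency k (m + k) =
      ∑ p : Nat.Partition (m + k) with k ∈ p.parts, p.parts.count k := by
    rw [Finset.sum_filter_of_ne fun p _ h => ?_]
    · rfl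
    · exact Multiset.count_ne_zero.1 h
  rw [h, sum_partition_filter_mem (fun s => s.count k) hk, partitionCount_zero_left]
  simp [partFrequency, Finset.sum_add_distrib, add_comm]

/-! ### Convergence of the partition series and Euler's product. -/

/-- If a power series is summable at `x`, so is its shift by `k`, with value multiplied by
`x ^ k`. -/
theorem hasSum_pow_mul_of_shift {f g : ℕ → ℂ} {k : ℕ} {x A : ℂ}
    (hlt : ∀ n < k, g n = 0) (hge : ∀ n, g (n + k) = f n)
    (hf : HasSum (fun n => f n * x ^ n) A) : HasSum (fun n => g n * x ^ n) (x ^ k * A) := by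
  rw [← hasSum_nat_add_iff' k, Finset.sum_eq_zero, sub_zero]
  · refine (hf.mul_left (x ^ k)).congr_fun fun n => ?_
    rw [hge]; ring
  · intro i hi
    simp [hlt i (Finset.mem_range.1 hi)]

theorem prod_one_sub_pow_pos {r : ℝ} (hr0 : 0 ≤ r) (hr : r < 1) (N : ℕ) :
    0 < ∏ k ∈ Finset.range N, (1 - r ^ (k + 1)) :=
  Finset.prod_pos fun k _ => sub_pos.2 (pow_lt_one₀ hr0 hr (by omega))

theorem tprod_one_sub_pow_ne_zero {q : ℂ} (hq : ‖q‖ < 1) : ∏' n : ℕ, (1 - q ^ (n + 1)) ≠ 0 := by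
  simp_rw [sub_eq_add_neg]
  refine tprod_one_add_ne_zero_of_summable (f := fun n => -q ^ (n + 1)) (fun i h => ?_) ?_
  · have h1 : q ^ (i + 1) = 1 := by linear_combination -h
    have h2 : ‖q‖ ^ (i + 1) < 1 := pow_lt_one₀ (norm_nonneg _) hq (by omega)
    rw [← norm_pow, h1, norm_one] at h2
    exact lt_irrefl _ h2
  · simpa using (summable_nat_add_iff 1).mpr (summable_geometric_of_lt_one (norm_nonneg _) hq)

/-- The finite products decrease to the infinite product, which is nonzero; its norm serves as the
uniform bound. -/
theorem exists_le_prod_one_sub_pow {r : ℝ} (hr0 : 0 ≤ r) (hr : r < 1) :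
    ∃ c : ℝ, 0 < c ∧ ∀ N : ℕ, c ≤ ∏ k ∈ Finset.range N, (1 - r ^ (k + 1)) := by
  have hq : ‖(r : ℂ)‖ < 1 := by simpa [abs_of_nonneg hr0] using hr
  have hanti : Antitone fun N : ℕ => ∏ k ∈ Finset.range N, (1 - r ^ (k + 1)) := by
    refine antitone_nat_of_succ_le fun N => ?_
    rw [Finset.prod_range_succ]
    exact mul_le_of_le_one_right (prod_one_sub_pow_pos hr0 hr N).le
      (sub_le_self _ (pow_nonneg hr0 _))
  have ht := (ModularForm.multipliable_one_sub_pow hq).hasProd.tendsto_prod_nat.norm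
  have heq : (fun N : ℕ => ‖∏ k ∈ Finset.range N, (1 - (r : ℂ) ^ (k + 1))‖) =
      fun N => ∏ k ∈ Finset.range N, (1 - r ^ (k + 1)) := by
    ext N
    rw [← abs_of_pos (prod_one_sub_pow_pos hr0 hr N), ← Real.norm_eq_abs, ← Complex.norm_real]
    push_cast
    rfl
  rw [heq] at ht
  exact ⟨_, norm_pos_iff.2 (tprod_one_sub_pow_ne_zero hq), fun N => hanti.le_of_tendsto ht N⟩

/-- A truncated form of multiplication by `1 - r^(N+1)`, usable before summability is known. -/
theorem sum_partitionCount_mul_pow_le {r : ℝ} (hr0 : 0 ≤ r) (N M : ℕ) :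
    (∑ n ∈ Finset.range M, (partitionCount N n : ℝ) * r ^ n) * (1 - r ^ (N + 1)) ≤
      ∑ n ∈ Finset.range M, (partitionCount (N + 1) n : ℝ) * r ^ n := by
  have key : ∑ n ∈ Finset.range M, (partitionCount N n : ℝ) * r ^ n ≤
      ∑ n ∈ Finset.range M, (partitionCount (N + 1) n : ℝ) * r ^ n +
        r ^ (N + 1) * ∑ n ∈ Finset.range M, (partitionCount N n : ℝ) * r ^ n := by
    have hsub : ∑ n ∈ Finset.range M, ((partitionCount N n : ℝ) -
        partitionCount (N + 1) n) * r ^ n ≤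
        r ^ (N + 1) * ∑ n ∈ Finset.range M, (partitionCount N n : ℝ) * r ^ n := by
      -- The terms are nonnegative, so the range may be lengthened by `N + 1`; after that the shift
      -- by `N + 1` is exact.
      calc _ ≤ ∑ n ∈ Finset.range (N + 1 + M), ((partitionCount N n : ℝ) -
            partitionCount (N + 1) n) * r ^ n := by
            refine Finset.sum_le_sum_of_subset_of_nonneg
              (Finset.range_subset_range.2 (by omega)) fun n _ _ => ?_
            refine mul_nonneg (sub_nonneg.2 ?_) (pow_nonneg hr0 _)
            rcases lt_or_ge n (N + 1) with h | h
            · rw [partitionCount_succ_of_lt h]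
            · obtain ⟨m, rfl⟩ := Nat.exists_eq_add_of_le' h
              rw [partitionCount_add]
              simp
        _ = _ := by
            rw [Finset.sum_range_add, Finset.sum_eq_zero, zero_add, Finset.mul_sum]
            · refine Finset.sum_congr rfl fun m _ => ?_
              rw [add_comm (N + 1) m, partitionCount_add]
              push_cast
              ring
            · intro n hn
              rw [partitionCount_succ_of_lt (Finset.mem_range.1 hn)]
              simp
    simp only [sub_mul, Finset.sum_sub_distrib] at hsub
    linarith
  linarith

theorem summable_partitionCount_mul_pow {r : ℝ} (hr0 : 0 ≤ r) (hr : r < 1) :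
    Summable fun n : ℕ => (partitionCount 0 n : ℝ) * r ^ n := by
  obtain ⟨c, hc, hcle⟩ := exists_le_prod_one_sub_pow hr0 hr
  refine summable_of_sum_range_le (c := 1 / c)
    (fun n => mul_nonneg (Nat.cast_nonneg _) (pow_nonneg hr0 _)) fun M => ?_
  have hN (N : ℕ) : (∑ n ∈ Finset.range M, (partitionCount 0 n : ℝ) * r ^ n) *
      ∏ k ∈ Finset.range N, (1 - r ^ (k + 1)) ≤
      ∑ n ∈ Finset.range M, (partitionCount N n : ℝ) * r ^ n := by
    induction N with
    | zero => simp
    | succ N ih =>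
      rw [Finset.prod_range_succ, ← mul_assoc]
      exact (mul_le_mul_of_nonneg_right ih (sub_nonneg.2 (pow_le_one₀ hr0 hr.le))).trans
        (sum_partitionCount_mul_pow_le hr0 N M)
  -- After `N = M` iterations only the coefficient at `n = 0` survives below `M`, so the partial
  -- sums are bounded by `1 / c`.
  have h1 : ∑ n ∈ Finset.range M, (partitionCount M n : ℝ) * r ^ n ≤ 1 := by
    refine (Finset.sum_le_sum (g := fun n => if n = 0 then (1 : ℝ) else 0) fun n hn => ?_).trans ?_
    · rcases eq_or_ne n 0 with rfl | h0
      · simp [partitionCount_zero]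
      · simp [partitionCount_eq_zero h0 (Finset.mem_range.1 hn).le, h0]
    · rw [Finset.sum_ite_eq']
      split_ifs <;> simp
  rw [le_div_iff₀ hc]
  refine le_trans ?_ ((hN M).trans h1)
  exact mul_le_mul_of_nonneg_left (hcle M)
    (Finset.sum_nonneg fun n _ => mul_nonneg (Nat.cast_nonneg _) (pow_nonneg hr0 _))

theorem hasSum_partitionCount {q : ℂ} (hq : ‖q‖ < 1) (N : ℕ) :
    HasSum (fun n : ℕ => (partitionCount N n : ℂ) * q ^ n)
      ((∑' n : ℕ, (partitionCount 0 n : ℂ) * q ^ n) * ∏ k ∈ Finset.range N, (1 - q ^ (k + 1))) := by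
  induction N with
  | zero =>
    simp only [Finset.range_zero, Finset.prod_empty, mul_one]
    refine (Summable.of_norm ?_).hasSum
    simpa using summable_partitionCount_mul_pow (norm_nonneg q) hq
  | succ N ih =>
    have hshift := hasSum_pow_mul_of_shift (k := N + 1)
      (g := fun n => (partitionCount N n : ℂ) - partitionCount (N + 1) n)
      (fun n hn => by simp [partitionCount_succ_of_lt hn])
      (fun n => by simp [partitionCount_add]) ih
    convert! ih.sub hshift using 1
    · ext n; ring
    · rw [Finset.prod_range_succ]; ring

/-- Euler's product formula for the generating function of the partition numbers. -/
theorem tsum_partitionCount_mul_tprod {q : ℂ} (hq : ‖q‖ < 1) :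
    (∑' n : ℕ, (partitionCount 0 n : ℂ) * q ^ n) * ∏' n : ℕ, (1 - q ^ (n + 1)) = 1 := by
  have h1 := (ModularForm.multipliable_one_sub_pow hq).hasProd.tendsto_prod_nat.const_mul
    (∑' n : ℕ, (partitionCount 0 n : ℂ) * q ^ n)
  refine tendsto_nhds_unique h1 ?_
  simp_rw [fun N => (hasSum_partitionCount hq N).tsum_eq.symm]
  -- As `N → ∞` each coefficient stabilises to that of the constant series `1`, dominated by the
  -- partition numbers.
  have h2 := tendsto_tsum_of_dominated_convergence (𝓕 := Filter.atTop)
    (f := fun N n : ℕ => (partitionCount N n : ℂ) * q ^ n)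
    (g := fun n => if n = 0 then 1 else 0)
    (bound := fun n => (partitionCount 0 n : ℝ) * ‖q‖ ^ n)
    (summable_partitionCount_mul_pow (norm_nonneg q) hq) (fun n => ?_)
    (Filter.Eventually.of_forall fun N n => ?_)
  · simpa using h2
  · refine tendsto_const_nhds.congr' ?_
    filter_upwards [Filter.eventually_ge_atTop n] with N hN
    rcases eq_or_ne n 0 with rfl | h0
    · simp [partitionCount_zero]
    · simp [partitionCount_eq_zero h0 hN, h0]
  · rw [norm_mul, norm_pow, Complex.norm_natCast]
    gcongr
    exact partitionCount_le N n

/-! ### Generating functions of part frequencies and their moments. -/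

theorem partFrequency_le (k n : ℕ) : partFrequency k n ≤ n * partitionCount 0 n := by
  rw [partitionCount_zero_left, mul_comm]
  refine (Finset.sum_le_card_nsmul _ _ n fun p _ => ?_).trans_eq (by simp)
  rcases eq_or_ne k 0 with rfl | hk
  · rw [Multiset.count_eq_zero.2 fun h => lt_irrefl _ (p.parts_pos h)]
    exact Nat.zero_le _
  · have hle : Multiset.replicate (p.parts.count k) k ≤ p.parts :=
      Multiset.le_count_iff_replicate_le.1 le_rfl
    obtain ⟨u, hu⟩ := Multiset.le_iff_exists_add.1 hle
    have := congrArg Multiset.sum hu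
    rw [p.parts_sum, Multiset.sum_add, Multiset.sum_replicate, smul_eq_mul] at this
    exact (Nat.le_mul_of_pos_right _ (Nat.pos_of_ne_zero hk)).trans (by omega)

theorem summable_partFrequency {q : ℂ} (hq : ‖q‖ < 1) {k : ℕ} :
    Summable fun n : ℕ => (partFrequency k n : ℂ) * q ^ n := by
  -- The gap between `‖q‖` and `r` absorbs the factor `n` of `partFrequency_le`, as `n (‖q‖ / r)^n`
  -- is bounded.
  obtain ⟨r, hr1, hr2⟩ := exists_between hq
  have hr0 : 0 < r := (norm_nonneg q).trans_lt hr1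
  have hx : ‖‖q‖ / r‖ < 1 := by
    rw [Real.norm_of_nonneg (by positivity)]
    exact (div_lt_one hr0).2 hr1
  have hb := (summable_pow_mul_geometric_of_norm_lt_one 1 hx).tendsto_atTop_zero.bddAbove_range
  obtain ⟨B, hB⟩ := hb
  refine Summable.of_norm_bounded ((summable_partitionCount_mul_pow hr0.le hr2).mul_left B)
    fun n => ?_
  have h1 : (n : ℝ) * (‖q‖ / r) ^ n ≤ B := by simpa using hB ⟨n, rfl⟩
  have h2 : (n : ℝ) * ‖q‖ ^ n ≤ B * r ^ n := by
    rwa [div_pow, ← mul_div_assoc, div_le_iff₀ (pow_pos hr0 n)] at h1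
  have h3 : (partFrequency k n : ℝ) ≤ n * partitionCount 0 n := mod_cast partFrequency_le k n
  rw [norm_mul, norm_pow, Complex.norm_natCast]
  calc _ ≤ ((n : ℝ) * partitionCount 0 n) * ‖q‖ ^ n := by gcongr
    _ = partitionCount 0 n * ((n : ℝ) * ‖q‖ ^ n) := by ring
    _ ≤ partitionCount 0 n * (B * r ^ n) := by gcongr
    _ = _ := by ring

theorem one_sub_pow_ne_zero {q : ℂ} (hq : ‖q‖ < 1) {k : ℕ} (hk : 1 ≤ k) : 1 - q ^ k ≠ 0 := by
  intro h
  have h2 : ‖q‖ ^ k < 1 := pow_lt_one₀ (norm_nonneg _) hq (by omega)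
  rw [← norm_pow, ← sub_eq_zero.1 h, norm_one] at h2
  exact lt_irrefl _ h2

theorem hasSum_partFrequency {q : ℂ} (hq : ‖q‖ < 1) {k : ℕ} (hk : 1 ≤ k) :
    HasSum (fun n : ℕ => (partFrequency k n : ℂ) * q ^ n)
      ((∑' n : ℕ, (partitionCount 0 n : ℂ) * q ^ n) * (q ^ k / (1 - q ^ k))) := by
  have hP := hasSum_partitionCount hq 0
  have hF := (summable_partFrequency hq (k := k)).hasSum
  have hadd := hP.add hF
  have hs := hasSum_pow_mul_of_shift (k := k) (g := fun n => (partFrequency k n : ℂ))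
    (f := fun n => (partitionCount 0 n : ℂ) + partFrequency k n)
    (fun n hn => by simp [partFrequency_eq_zero_of_lt hn])
    (fun n => by simp [partFrequency_add hk]) (by simpa only [add_mul] using hadd)
  -- This is `A = q^k (P + A)`, to be solved for `A`.
  have heq := hF.unique hs
  convert hF using 1
  have := one_sub_pow_ne_zero hq hk
  simp only [Finset.range_zero, Finset.prod_empty, mul_one] at heq
  field_simp
  linear_combination -heq

theorem hasSum_pow_mul_partFrequency (s m : ℕ) (x : ℂ) :
    HasSum (fun k : ℕ+ => ((k : ℕ) : ℂ) ^ s * ((partFrequency k m : ℂ) * x))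
      ((frequencyMoment s m : ℂ) * x) := by
  have h : HasSum (fun k : ℕ => if 1 ≤ k then (k : ℂ) ^ s * ((partFrequency k m : ℂ) * x) else 0)
      ((frequencyMoment s m : ℂ) * x) := by
    have hs : (frequencyMoment s m : ℂ) * x = ∑ k ∈ Finset.Icc 1 m,
        if 1 ≤ k then (k : ℂ) ^ s * ((partFrequency k m : ℂ) * x) else 0 := by
      rw [frequencyMoment, Nat.cast_sum, Finset.sum_mul]
      refine Finset.sum_congr rfl fun k hk => ?_
      rw [if_pos (Finset.mem_Icc.1 hk).1]
      push_cast
      ring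
    rw [hs]
    refine hasSum_sum_of_ne_finset_zero fun k hk => ?_
    rw [Finset.mem_Icc, not_and, not_le] at hk
    split_ifs with h1
    · simp [partFrequency_eq_zero_of_lt (hk h1)]
    · rfl
  have h' := (Function.Injective.hasSum_iff PNat.coe_injective fun k hk => ?_).2 h
  · exact h'.congr_fun fun k => by simp
  · rw [if_neg]
    intro h1
    exact hk ⟨⟨k, h1⟩, rfl⟩

/-- The generating function of the frequency moments. -/
theorem hasSum_frequencyMoment {q : ℂ} (hq : ‖q‖ < 1) (s : ℕ) :
    HasSum (fun m : ℕ => (frequencyMoment s m : ℂ) * q ^ m)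
      ((∑' n : ℕ, (partitionCount 0 n : ℂ) * q ^ n) *
        ∑' m : ℕ+, (ArithmeticFunction.sigma s m : ℂ) * q ^ (m : ℕ)) := by
  have hfib {x : ℂ} (hx : ‖x‖ < 1) (k : ℕ+) :
      HasSum (fun m : ℕ => ((k : ℕ) : ℂ) ^ s * ((partFrequency k m : ℂ) * x ^ m))
        ((∑' n : ℕ, (partitionCount 0 n : ℂ) * x ^ n) *
          (((k : ℕ) : ℂ) ^ s * x ^ (k : ℕ) / (1 - x ^ (k : ℕ)))) := by
    rw [mul_div_assoc, mul_left_comm]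
    exact (hasSum_partFrequency hx k.pos).mul_left _
  have hdiag {x : ℂ} (hx : ‖x‖ < 1) :
      Summable fun k : ℕ+ => (∑' n : ℕ, (partitionCount 0 n : ℂ) * x ^ n) *
          (((k : ℕ) : ℂ) ^ s * x ^ (k : ℕ) / (1 - x ^ (k : ℕ))) :=
    ((summable_norm_pow_mul_geometric_div_one_sub s hx).comp_injective
      PNat.coe_injective).mul_left _
  have hsum : Summable fun c : ℕ+ × ℕ =>
      ((c.1 : ℕ) : ℂ) ^ s * ((partFrequency c.1 c.2 : ℂ) * q ^ c.2) := by
    -- At the real point `‖q‖` all terms are nonnegative, so the sums of norms along the fibres are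
    -- given by the same closed form.
    have hx : ‖((‖q‖ : ℝ) : ℂ)‖ < 1 := by simpa using hq
    have hnorm (k : ℕ+) (m : ℕ) : ‖((k : ℕ) : ℂ) ^ s * ((partFrequency k m : ℂ) * q ^ m)‖ =
        ‖((k : ℕ) : ℂ) ^ s * ((partFrequency k m : ℂ) * ((‖q‖ : ℝ) : ℂ) ^ m)‖ := by simp
    have hreal (k : ℕ+) (m : ℕ) :
        ((‖((k : ℕ) : ℂ) ^ s * ((partFrequency k m : ℂ) * q ^ m)‖ : ℝ) : ℂ) =
        ((k : ℕ) : ℂ) ^ s * ((partFrequency k m : ℂ) * ((‖q‖ : ℝ) : ℂ) ^ m) := by simp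
    refine Summable.of_norm ((summable_prod_of_nonneg fun _ => norm_nonneg _).2 ⟨fun k => ?_, ?_⟩)
    · exact (hfib hq k).summable.norm
    · have h := (hdiag hx).norm
      refine h.congr fun k => ?_
      rw [← (hfib hx k).tsum_eq, ← tsum_congr (hreal k), ← Complex.ofReal_tsum,
        Complex.norm_real, Real.norm_of_nonneg (tsum_nonneg fun _ => norm_nonneg _)]
  have htot : ∑' c : ℕ+ × ℕ, ((c.1 : ℕ) : ℂ) ^ s * ((partFrequency c.1 c.2 : ℂ) * q ^ c.2) =
      (∑' n : ℕ, (partitionCount 0 n : ℂ) * q ^ n) *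
        ∑' m : ℕ+, (ArithmeticFunction.sigma s m : ℂ) * q ^ (m : ℕ) := by
    rw [← tsum_pow_div_one_sub_eq_tsum_sigma hq, ← tsum_mul_left, hsum.tsum_prod]
    exact tsum_congr fun k => (hfib hq k).tsum_eq
  rw [← htot]
  have hswap := (Equiv.prodComm ℕ ℕ+).hasSum_iff.2 hsum.hasSum
  exact hswap.prod_fiberwise fun m => hasSum_pow_mul_partFrequency s m (q ^ m)

/-! ### Rational `q`-expansions and polynomials in `j`. -/

open UpperHalfPlane ModularForm MatrixGroups

/-- A complex power series with rational coefficients. -/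
def IsRationalSeries (f : PowerSeries ℂ) : Prop :=
  f ∈ (PowerSeries.map (algebraMap ℚ ℂ)).range

theorem isRationalSeries_of_coeff {f : PowerSeries ℂ} (h : ∀ m, ∃ c : ℚ, f.coeff m = c) :
    IsRationalSeries f := by
  choose c hc using h
  refine ⟨PowerSeries.mk c, ?_⟩
  ext m
  simp [hc]

theorem IsRationalSeries.coeff {f : PowerSeries ℂ} (hf : IsRationalSeries f) (m : ℕ) :
    ∃ c : ℚ, f.coeff m = c := by
  obtain ⟨g, rfl⟩ := hf
  exact ⟨g.coeff m, by simp⟩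

theorem isRationalSeries_E {k : ℕ} (hk : 3 ≤ k) (hk2 : Even k) :
    IsRationalSeries (qExpansion 1 (E hk)) := by
  refine isRationalSeries_of_coeff fun m => ?_
  rw [EisensteinSeries.E_qExpansion_coeff hk hk2]
  refine ⟨if m = 0 then 1 else -(2 * k / bernoulli k) * (ArithmeticFunction.sigma (k - 1) m), ?_⟩
  split_ifs <;> simp

theorem IsRationalSeries.smul {f : PowerSeries ℂ} (hf : IsRationalSeries f) (c : ℚ) :
    IsRationalSeries ((c : ℂ) • f) := by
  obtain ⟨g, rfl⟩ := hf
  refine ⟨c • g, ?_⟩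
  ext m
  simp

/-- Follows from `1728 Δ = E₄^3 - E₆^2`. -/
theorem isRationalSeries_discriminant : IsRationalSeries (qExpansion 1 discriminant) := by
  have h4 : IsRationalSeries (qExpansion 1 E₄) := isRationalSeries_E _ ⟨2, rfl⟩
  have h6 : IsRationalSeries (qExpansion 1 E₆) := isRationalSeries_E _ ⟨3, rfl⟩
  have hfun : discriminant = ((1 / 1728 : ℚ) : ℂ) •
      (mcast (by decide) (E₄.pow 3) - mcast (by decide) (E₆.pow 2) : ModularForm 𝒮ℒ 12) := by
    ext z
    rw [discriminant_eq_E₄_cube_sub_E₆_sq]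
    simp only [Pi.smul_apply, sub_apply, coe_mcast, coe_pow, Pi.pow_apply,
      smul_eq_mul]
    push_cast
    ring
  rw [hfun, ModularForm.qExpansion_smul one_pos one_mem_strictPeriods_SL, FunLike.coe_sub,
    ModularForm.qExpansion_sub one_pos one_mem_strictPeriods_SL, coe_mcast, coe_mcast,
    ModularForm.qExpansion_pow one_pos one_mem_strictPeriods_SL,
    ModularForm.qExpansion_pow one_pos one_mem_strictPeriods_SL]
  exact IsRationalSeries.smul (Subring.sub_mem _ (Subring.pow_mem _ h4 3)
    (Subring.pow_mem _ h6 2)) _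

/-- Division of rational power series by a rational power series of order one. -/
theorem IsRationalSeries.of_mul {d g : PowerSeries ℂ} (hd : IsRationalSeries d)
    (hd0 : d.coeff 0 = 0) (hd1 : d.coeff 1 ≠ 0) (h : IsRationalSeries (d * g)) :
    IsRationalSeries g := by
  obtain ⟨D, rfl⟩ := hd
  obtain ⟨H, hH⟩ := h
  have hD0 : PowerSeries.constantCoeff D = 0 := by
    simpa using hd0
  -- A series of order one is not invertible, so `X` is cancelled on both sides; the cofactor `U` is
  -- a unit over `ℚ`.
  obtain ⟨U, rfl⟩ := PowerSeries.X_dvd_iff.2 hD0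
  have hH0 : PowerSeries.constantCoeff H = 0 := by
    have := congrArg (PowerSeries.coeff 0) hH
    simpa using this
  obtain ⟨K, rfl⟩ := PowerSeries.X_dvd_iff.2 hH0
  have hU : PowerSeries.constantCoeff U ≠ 0 := by
    intro h0
    apply hd1
    rw [map_mul, PowerSeries.map_X, show (1 : ℕ) = 0 + 1 from rfl, PowerSeries.coeff_succ_X_mul]
    simp [h0]
  simp only [map_mul, PowerSeries.map_X, mul_assoc] at hH
  have hH' := mul_left_cancel₀ PowerSeries.X_ne_zero hH
  refine ⟨U⁻¹ * K, ?_⟩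
  rw [map_mul, hH', ← mul_assoc, ← map_mul, PowerSeries.inv_mul_cancel _ hU, map_one, one_mul]

theorem discriminant_mul_kleinJ (τ : ℍ) : discriminant τ * kleinJ τ = E₄ τ ^ 3 := by
  rw [kleinJ, mul_div_cancel₀ _ (discriminant_ne_zero τ)]

/-- A level one form of weight `12 n` with rational `q`-expansion is `Δ ^ n P(j)` for a rational
polynomial `P`. -/
theorem exists_polynomial_kleinJ (n : ℕ) (f : ModularForm 𝒮ℒ ((12 * n : ℕ) : ℤ))
    (hf : IsRationalSeries (qExpansion 1 f)) :
    ∃ P : Polynomial ℚ, ∀ τ : ℍ, f τ = discriminant τ ^ n * Polynomial.aeval (kleinJ τ) P := by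
  induction n with
  | zero =>
    obtain ⟨c, hc⟩ := hf.coeff 0
    obtain ⟨a, ha⟩ := ModularFormClass.levelOne_weight_zero_const
      (mcast (by simp) f : ModularForm 𝒮ℒ 0)
    have ha' : (f : ℍ → ℂ) = Function.const ℍ a := ha
    have hca : (c : ℂ) = a := by
      have h1 : (f : ℍ → ℂ) = a • ⇑(1 : ModularForm 𝒮ℒ 0) := by
        rw [ha']; ext; simp
      rw [h1, ModularForm.qExpansion_smul one_pos one_mem_strictPeriods_SL,
        ModularForm.qExpansion_one] at hc
      simpa using hc.symm
    exact ⟨Polynomial.C c, fun τ => by simp [ha', ← hca]⟩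
  | succ n ih =>
    obtain ⟨c, hc⟩ := hf.coeff 0
    let e : ModularForm 𝒮ℒ ((12 * (n + 1) : ℕ) : ℤ) :=
      mcast (by push_cast; ring) (E₄.pow (3 * (n + 1)))
    have he (τ : ℍ) : e τ = E₄ τ ^ (3 * (n + 1)) := by
      simp only [e, coe_mcast, coe_pow, Pi.pow_apply]
    have heq : qExpansion 1 e = qExpansion 1 E₄ ^ (3 * (n + 1)) := by
      simp only [e, coe_mcast, ModularForm.qExpansion_pow one_pos one_mem_strictPeriods_SL]
    have h4 : IsRationalSeries (qExpansion 1 E₄) := isRationalSeries_E _ ⟨2, rfl⟩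
    have he0 : (qExpansion 1 e).coeff 0 = 1 := by
      have : (qExpansion 1 E₄).coeff 0 = 1 := EisensteinSeries.E_qExpansion_coeff_zero _ ⟨2, rfl⟩
      rw [PowerSeries.coeff_zero_eq_constantCoeff] at this
      rw [heq, PowerSeries.coeff_zero_eq_constantCoeff, map_pow]
      erw [this]
      simp
    -- Since `E₄^(3(n+1)) = Δ^(n+1) j^(n+1)`, the subtracted form contributes the top monomial of
    -- the polynomial; what remains is a cusp form, hence `Δ` times a form of weight `12 n`.
    let h : ModularForm 𝒮ℒ ((12 * (n + 1) : ℕ) : ℤ) := f - (c : ℂ) • e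
    have hq : qExpansion 1 h = qExpansion 1 f - (c : ℂ) • qExpansion 1 e := by
      simp only [h, FunLike.coe_sub, FunLike.coe_smul]
      rw [← ModularForm.qExpansion_smul one_pos one_mem_strictPeriods_SL]
      exact ModularForm.qExpansion_sub one_pos one_mem_strictPeriods_SL f ((c : ℂ) • e)
    have h0 : (qExpansion 1 h).coeff 0 = 0 := by
      rw [hq, map_sub, PowerSeries.coeff_smul, he0, hc]
      simp
    have hrat : IsRationalSeries (qExpansion 1 h) := by
      rw [hq]
      exact Subring.sub_mem _ hf (IsRationalSeries.smul (heq ▸ Subring.pow_mem _ h4 _) c)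
    let g : ModularForm 𝒮ℒ ((12 * n : ℕ) : ℤ) :=
      mcast (by push_cast; ring) (CuspForm.discriminantEquiv (toCuspForm h h0))
    have hg (τ : ℍ) : discriminant τ * g τ = h τ :=
      discriminant_mul_discriminantEquiv_apply (toCuspForm h h0) τ
    have hgrat : IsRationalSeries (qExpansion 1 g) := by
      refine isRationalSeries_discriminant.of_mul ?_ ?_ ?_
      · exact PowerSeries.coeff_of_lt_order _ (by rw [discriminant_qExpansion_order]; simp)
      · rw [discriminant_qExpansion_coeff_one]; exact one_ne_zero
      · rw [qExpansion_eq_qExpansion_discriminant_mul h h0] at hrat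
        exact hrat
    obtain ⟨P, hP⟩ := ih g hgrat
    refine ⟨P + Polynomial.C c * Polynomial.X ^ (n + 1), fun τ => ?_⟩
    have hf' : f τ = h τ + c * e τ := by
      simp [h]
    have hE : E₄ τ ^ (3 * (n + 1)) = discriminant τ ^ (n + 1) * kleinJ τ ^ (n + 1) := by
      rw [pow_mul, ← discriminant_mul_kleinJ, mul_pow]
    rw [hf', ← hg, hP, he, hE]
    simp
    ring

/-! ### Growth of `j` at the cusp and uniqueness. -/

theorem tendsto_E₄_atImInfty : Filter.Tendsto (E₄ : ℍ → ℂ) atImInfty (nhds 1) := by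
  have hanal := ModularFormClass.analyticAt_cuspFunction_zero E₄ one_pos one_mem_strictPeriods_SL
  have hper := SlashInvariantFormClass.periodic_comp_ofComplex E₄ one_mem_strictPeriods_SL
  have h0 : (qExpansion 1 E₄).coeff 0 = 1 := EisensteinSeries.E_qExpansion_coeff_zero _ ⟨2, rfl⟩
  rw [← h0, qExpansion_coeff_zero one_pos hanal hper, ← cuspFunction_apply_zero one_pos hanal hper]
  exact (hanal.continuousAt.tendsto.comp (qParam_tendsto_atImInfty one_pos)).congr
    fun τ => SlashInvariantFormClass.eq_cuspFunction E₄ τ one_mem_strictPeriods_SL one_ne_zero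

theorem tendsto_norm_kleinJ_atImInfty :
    Filter.Tendsto (fun τ => ‖kleinJ τ‖) atImInfty Filter.atTop := by
  have hΔ : Filter.Tendsto (fun τ => ‖discriminant τ‖) atImInfty (nhdsWithin 0 (Set.Ioi 0)) := by
    refine tendsto_nhdsWithin_iff.2 ⟨?_, Filter.Eventually.of_forall fun τ =>
      norm_pos_iff.2 (discriminant_ne_zero τ)⟩
    simpa using (show Filter.Tendsto discriminant atImInfty (nhds 0) from
      discriminant_isZeroAtImInfty).norm
  have h4 : Filter.Tendsto (fun τ => ‖E₄ τ ^ 3‖) atImInfty (nhds 1) := by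
    simpa using (tendsto_E₄_atImInfty.pow 3).norm
  have := h4.pos_mul_atTop one_pos hΔ.inv_tendsto_nhdsGT_zero
  refine this.congr fun τ => ?_
  simp [kleinJ, div_eq_mul_inv]

/-- The function `j` is transcendental over `ℚ`. -/
theorem eq_zero_of_aeval_kleinJ_eq_zero (P : Polynomial ℚ)
    (h : ∀ τ : ℍ, Polynomial.aeval (kleinJ τ) P = 0) : P = 0 := by
  by_contra hP
  have hfin : (P.rootSet ℂ).Finite := P.rootSet_finite ℂ
  -- A nonzero `P` has finitely many roots, hence bounded ones, whereas `j` takes arbitrarily large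
  -- values.
  obtain ⟨B, hB⟩ := hfin.isBounded.exists_norm_le
  obtain ⟨τ, hτ⟩ := (tendsto_norm_kleinJ_atImInfty.eventually_gt_atTop B).exists
  exact absurd (hB _ ((Polynomial.mem_rootSet.2 ⟨hP, h τ⟩))) (not_le.2 hτ)

/-! ### Assembling the identity. -/

/-- Euler's formula makes `ζ(2k)` a multiple of `B_{2k}`, and `ζ` has no zeros with real part
greater than `1`. -/
theorem bernoulli_two_mul_ne_zero {k : ℕ} (hk : k ≠ 0) : bernoulli (2 * k) ≠ 0 := by
  intro h
  have h1 := riemannZeta_two_mul_nat hk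
  rw [h] at h1
  refine riemannZeta_ne_zero_of_one_lt_re (s := 2 * k) ?_ (by simpa using h1)
  have : (1 : ℝ) ≤ k := mod_cast Nat.one_le_iff_ne_zero.2 hk
  simp
  linarith

theorem inv_eta_eq (τ : ℍ) :
    (eta τ)⁻¹ = Complex.exp (-(2 * Real.pi * Complex.I * τ) / 24) *
      ∑' n : ℕ, (partitionCount 0 n : ℂ) * Complex.exp (2 * Real.pi * Complex.I * τ) ^ n := by
  have h := tsum_partitionCount_mul_tprod (norm_exp_two_pi_I_lt_one τ)
  have heta : eta τ = Complex.exp (2 * Real.pi * Complex.I * τ / 24) *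
      ∏' n : ℕ, (1 - Complex.exp (2 * Real.pi * Complex.I * τ) ^ (n + 1)) := by
    rw [eta]
    simp only [eta_q_eq_pow, Function.Periodic.qParam, Complex.ofReal_ofNat]
  rw [heta, neg_div, Complex.exp_neg, mul_inv, eq_inv_of_mul_eq_one_left h]

/-- The usual factor `-2k / B_k` at weight `k = 12n` is `C_{12n}`. -/
theorem E_eq_one_add_eisensteinConstant_mul {n : ℕ} (hn : 1 ≤ n) (τ : ℍ) :
    E (k := 12 * n) (by omega) τ = 1 + ((eisensteinConstant n : ℚ) : ℂ) *
      ∑' m : ℕ+, (ArithmeticFunction.sigma (12 * n - 1) m : ℂ) *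
        Complex.exp (2 * Real.pi * Complex.I * τ) ^ (m : ℕ) := by
  rw [EisensteinSeries.q_expansion_bernoulli (by omega) ⟨6 * n, by ring⟩]
  simp only [zpow_natCast, eisensteinConstant]
  push_cast
  ring

theorem mainTheorem7 (n : ℕ) (hn : 1 ≤ n) :
    bernoulli (12 * n) ≠ 0 ∧
    (∃! P : Polynomial ℚ, IsEisensteinPolynomial n hn P) ∧
    ∀ P : Polynomial ℚ, IsEisensteinPolynomial n hn P → ∀ τ : UpperHalfPlane,
      Summable (fun m : ℕ+ =>
        (frequencyMoment (12 * n - 1) m : ℂ) *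
          Complex.exp (2 * Real.pi * Complex.I * τ) ^ (m : ℕ)) ∧
      Complex.exp (-(2 * Real.pi * Complex.I * τ) / 24) *
          ∑' m : ℕ+, (frequencyMoment (12 * n - 1) m : ℂ) *
            Complex.exp (2 * Real.pi * Complex.I * τ) ^ (m : ℕ) =
        1 / ((eisensteinConstant n : ℚ) : ℂ) *
          (ModularForm.eta τ ^ (24 * n - 1) * Polynomial.aeval (kleinJ τ) P -
            (ModularForm.eta τ)⁻¹) := by
  have hB : bernoulli (12 * n) ≠ 0 := by
    rw [show 12 * n = 2 * (6 * n) by ring]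
    exact bernoulli_two_mul_ne_zero (by omega)
  refine ⟨hB, ?_, fun P hP τ => ?_⟩
  · obtain ⟨P, hP⟩ := exists_polynomial_kleinJ n (E (k := 12 * n) (by omega))
      (isRationalSeries_E _ ⟨6 * n, by ring⟩)
    refine ⟨P, hP, fun Q hQ => sub_eq_zero.1 (eq_zero_of_aeval_kleinJ_eq_zero _ fun τ => ?_)⟩
    have h := (hQ τ).symm.trans (hP τ)
    rw [map_sub, mul_left_cancel₀ (pow_ne_zero _ (discriminant_ne_zero τ)) h, sub_self]
  · have hq := norm_exp_two_pi_I_lt_one τ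
    set q := Complex.exp (2 * Real.pi * Complex.I * τ) with hqdef
    have hM := hasSum_frequencyMoment hq (12 * n - 1)
    -- The moment at `m = 0` is an empty sum, so summing over `ℕ` or `ℕ+` is the same.
    have hM0 : ∀ m ∉ Set.range ((↑) : ℕ+ → ℕ),
        (frequencyMoment (12 * n - 1) m : ℂ) * q ^ m = 0 := fun m hm => by
      have : m = 0 := by
        by_contra h
        exact hm ⟨⟨m, Nat.pos_of_ne_zero h⟩, rfl⟩
      simp [this, frequencyMoment]
    have hM' := (PNat.coe_injective.hasSum_iff hM0).2 hM
    refine ⟨hM'.summable, ?_⟩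
    have hC : ((eisensteinConstant n : ℚ) : ℂ) ≠ 0 := by
      rw [Rat.cast_ne_zero, eisensteinConstant]
      have : (n : ℚ) ≠ 0 := by positivity
      exact div_ne_zero (by simpa using this) hB
    have hη : eta τ ≠ 0 := eta_ne_zero τ.2
    have hE := (hP τ).symm.trans (E_eq_one_add_eisensteinConstant_mul hn τ)
    -- The natural subtraction is exact because `n ≥ 1`.
    have hpow : eta τ ^ (24 * n - 1) = (eta τ)⁻¹ * discriminant τ ^ n := by
      rw [discriminant, ← pow_mul, eq_inv_mul_iff_mul_eq₀ hη, ← pow_succ']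
      congr 1
      omega
    erw [hM'.tsum_eq]
    rw [← mul_assoc, ← inv_eta_eq, hpow, mul_assoc (eta τ)⁻¹, hE, ← hqdef]
    field_simp
    ring
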